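/- Let $X$ be a complex Banach space and $(\mathcal A(t),\mathcal D(\mathcal A(t)))_{t\in\mathbb R}$ a family of linear operators on $X$, possibly unbounded, satisfying the following parabolic-type conditions. (P1) The domain $\mathcal D=\mathcal D(\mathcal A(t))$ is independent of $t\in\mathbb R$. (P2) For each $t\in\mathbb R$ the operator $\mathcal A(t)$ is sectorial (closed and densely defined; for some $0<\delta\le\pi/2$ the sector $\{z\neq0:|\arg z|<\pi/2+\delta\}$ lies in its resolvent set, and for every $0<\varepsilon<\delta$ there is $K_\varepsilon\ge1$ with $\|R(z,\mathcal A(t))\|\le K_\varepsilon/|z|$ whenever $z\ne0$ and $|\arg z|\le\pi/2+\delta-\varepsilon$) and generates an analytic semigroup $(e^{\tau\mathcal A(t)})_{\tau\ge0}$. Every $z\in\mathbb C$ with $\operatorname{Re}z\ge0$ lies in the resolvent set of every $\mathcal A(t)$, and there is a constant $K\ge1$ with $\|R(z,\mathcal A(t))\|\le K/(|z|+1)$ for all such $z$ and all $t\in\mathbb R$. There is $\omega\in\mathbb R$ with $\|e^{\tau\mathcal A(t)}\|\le e^{\omega\tau}$ for all $\tau\ge0$, $t\in\mathbb R$. (P3)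 There are $L\ge0$ and $0<\theta\le1$ with $\|(\mathcal A(t)-\mathcal A(s))\mathcal A(0)^{-1}\|\le L|t-s|^\theta$ for all $t,s\in\mathbb R$. Assume also that, for some exponents $0\le\alpha<\beta$ and some constant $C_0$, $$\|(\mathcal A(t)-\mathcal A(s))x\|\le C_0|t-s|^\beta\,\|\mathcal A(\tau)x\|^\alpha\,\|x\|^{1-\alpha}\qquad\text{for all }x\in\mathcal D\text{ and all }s\le\tau\le t.$$ Let $\{\mathcal U(t,s)\}_{t\ge s}$ be the solution operators of the Cauchy problem $u'(t)=\mathcal A(t)u(t)$ for $t\ge s$, $u(s)=x$. That is, they are bounded linear operators on $X$ with $\mathcal U(t,r)\,\mathcal U(r,s)=\mathcal U(t,s)$ for $t\ge r\ge s$ and $\mathcal U(t,t)=\mathrm{Id}$, the map $(t,s)\mapsto\mathcal U(t,s)$ is strongly continuous, $\|\mathcal U(t,s)\|\le e^{\omega'(t-s)}$ for some $\omega'\in\mathbb R$ and all $t\ge s$, and for every $s\in\mathbb R$ the set of those $y\in X$ for which $t\mapsto\mathcal U(t,s)y$ is a classical solution on $[s,\infty)$ with initial value $y$ ($C^1$ on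 $[s,\infty)$, with values in $\mathcal D$, satisfying the equation for all $t\ge s$) is dense in $X$. Then for every $T>0$ there is a constant $C(T)$ such that for every integer $M\ge1$, with $\Delta t=T/M$, $$\Big\|\mathcal U(T,0)-\prod_{k=0}^{M-1}e^{\Delta t\,\mathcal A(k\Delta t)}\Big\|\le C(T)\,(\Delta t)^{\beta-\alpha}$$ in the operator norm of $X$, where the product is time-ordered: $e^{\Delta t\mathcal A((M-1)\Delta t)}\cdots e^{\Delta t\mathcal A(\Delta t)}\,e^{\Delta t\mathcal A(0)}$. -/

import Mathlib

open Set Filter Topology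

namespace NCP

variable {X : Type*} [NormedAddCommGroup X] [NormedSpace ℂ X]

/-- `R` is a bounded two-sided inverse of `z - A : D(A) → X`. -/
def IsResolventAt (A : X →ₗ.[ℂ] X) (z : ℂ) (R : X →L[ℂ] X) : Prop :=
  (∀ y : X, ∃ h : R y ∈ A.domain, z • R y - A ⟨R y, h⟩ = y) ∧
    ∀ x : A.domain, R (z • (x : X) - A x) = x

/-- The resolvent set of the (possibly unbounded) operator `A`. -/
def resolventSet (A : X →ₗ.[ℂ] X) : Set ℂ :=
  {z | ∃ R : X →L[ℂ] X, IsResolventAt A z R}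

open Classical in
/-- The resolvent `R(z, A) = (z - A)⁻¹`, for `z` in the resolvent set (and `0` otherwise). -/
noncomputable def resolvent (A : X →ₗ.[ℂ] X) (z : ℂ) : X →L[ℂ] X :=
  if h : ∃ R : X →L[ℂ] X, IsResolventAt A z R then h.choose else 0

/-- The inverse `A⁻¹ = -R(0, A)`, a bounded operator on `X` if `0` is in the resolvent set. -/
noncomputable def inverse (A : X →ₗ.[ℂ] X) : X →L[ℂ] X := -resolvent A 0

/-- The open sector of half-angle `φ` around the positive real axis, without its vertex. -/
def sector (φ : ℝ) : Set ℂ := {z | z ≠ 0 ∧ |z.arg| < φ}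

/-- Sectorial operator: closed, densely defined, the open sector of half-angle `π/2 + δ` lies in
the resolvent set, and `‖R(z, A)‖ ≤ K / |z|` on every smaller closed sector. -/
def IsSectorial (A : X →ₗ.[ℂ] X) : Prop :=
  A.IsClosed ∧ Dense (A.domain : Set X) ∧
    ∃ δ : ℝ, 0 < δ ∧ δ ≤ Real.pi / 2 ∧
      sector (Real.pi / 2 + δ) ⊆ resolventSet A ∧
      ∀ ε : ℝ, 0 < ε → ε < δ → ∃ K : ℝ, 1 ≤ K ∧
        ∀ z : ℂ, z ≠ 0 → |z.arg| ≤ Real.pi / 2 + δ - ε → ‖resolvent A z‖ ≤ K / ‖z‖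

/-- Strongly continuous one-parameter semigroup `(S τ)_{τ ≥ 0}` of bounded operators; the values of
`S` at negative arguments are irrelevant. -/
structure IsC0Semigroup (S : ℝ → X →L[ℂ] X) : Prop where
  zero : S 0 = ContinuousLinearMap.id ℂ X
  add : ∀ s t : ℝ, 0 ≤ s → 0 ≤ t → S (s + t) = (S s).comp (S t)
  continuousOn : ∀ x : X, ContinuousOn (fun t => S t x) (Ici 0)

/-- `A` is the infinitesimal generator of `S`: `x ∈ D(A)` and `A x = y` if and only if
`(S h x - x) / h → y` as `h ↓ 0`. -/
def IsGenerator (S : ℝ → X →L[ℂ] X) (A : X →ₗ.[ℂ] X) : Prop :=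
  ∀ x y : X, (∃ h : x ∈ A.domain, A ⟨x, h⟩ = y) ↔
    Tendsto (fun h : ℝ => h⁻¹ • (S h x - x)) (𝓝[>] 0) (𝓝 y)

/-- `A` generates a strongly continuous semigroup. -/
def Generates (A : X →ₗ.[ℂ] X) : Prop :=
  ∃ S : ℝ → X →L[ℂ] X, IsC0Semigroup S ∧ IsGenerator S A

open Classical in
/-- The semigroup `τ ↦ e^{τ A}`, `τ ≥ 0`, generated by `A` (it is unique on `τ ≥ 0`), and `0` if
`A` is not a generator. -/
noncomputable def expSemigroup (A : X →ₗ.[ℂ] X) : ℝ → X →L[ℂ] X :=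
  if h : Generates A then h.choose else 0

/-- `(S τ)_{τ ≥ 0}` extends to an analytic semigroup on a sector. -/
def IsAnalyticSemigroup (S : ℝ → X →L[ℂ] X) : Prop :=
  ∃ δ : ℝ, 0 < δ ∧ δ ≤ Real.pi / 2 ∧ ∃ E : ℂ → X →L[ℂ] X,
    (∀ τ : ℝ, 0 ≤ τ → E (τ : ℂ) = S τ) ∧
    E 0 = ContinuousLinearMap.id ℂ X ∧
    (∀ z ∈ sector δ, ∀ w ∈ sector δ, E (z + w) = (E z).comp (E w)) ∧
    DifferentiableOn ℂ E (sector δ) ∧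
    ∀ δ' : ℝ, 0 < δ' → δ' < δ → ∀ x : X, Tendsto (fun z => E z x) (𝓝[sector δ'] 0) (𝓝 x)

/-- `A` generates an analytic semigroup. -/
def GeneratesAnalytic (A : X →ₗ.[ℂ] X) : Prop :=
  Generates A ∧ IsAnalyticSemigroup (expSemigroup A)

/-- The parabolic-type conditions on the family `(A t)_{t ∈ ℝ}`. -/
structure Parabolic (A : ℝ → X →ₗ.[ℂ] X) : Prop where
  domain_eq : ∀ s t : ℝ, (A s).domain = (A t).domain
  sectorial : ∀ t : ℝ, IsSectorial (A t)
  analytic : ∀ t : ℝ, GeneratesAnalytic (A t)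
  resolvent_mem : ∀ (t : ℝ) (z : ℂ), 0 ≤ z.re → z ∈ resolventSet (A t)
  resolvent_bound : ∃ M : ℝ, 1 ≤ M ∧ ∀ (t : ℝ) (z : ℂ), 0 ≤ z.re →
    ‖resolvent (A t) z‖ ≤ M / (‖z‖ + 1)
  exp_bound : ∃ ω : ℝ, ∀ t τ : ℝ, 0 ≤ τ → ‖expSemigroup (A t) τ‖ ≤ Real.exp (ω * τ)
  /-- `‖(A t - A s) (A 0)⁻¹‖ ≤ L |t - s| ^ θ` as an operator on `X`; the two membership hypotheses
  always hold, since all domains agree and `(A 0)⁻¹` maps into `D(A 0)`. -/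
  holder : ∃ L θ : ℝ, 0 ≤ L ∧ 0 < θ ∧ θ ≤ 1 ∧ ∀ (t s : ℝ) (y : X)
    (ht : inverse (A 0) y ∈ (A t).domain) (hs : inverse (A 0) y ∈ (A s).domain),
    ‖A t ⟨inverse (A 0) y, ht⟩ - A s ⟨inverse (A 0) y, hs⟩‖ ≤ L * |t - s| ^ θ * ‖y‖

/-- The interpolated Hölder condition with exponents `0 ≤ α < β`, for `x` in the (common) domain
and all `s ≤ τ ≤ t`. -/
def HolderCondition (A : ℝ → X →ₗ.[ℂ] X) (α β : ℝ) : Prop :=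
  0 ≤ α ∧ α < β ∧ ∃ C : ℝ, ∀ s τ t : ℝ, s ≤ τ → τ ≤ t → ∀ (x : X)
    (hs : x ∈ (A s).domain) (hτ : x ∈ (A τ).domain) (ht : x ∈ (A t).domain),
    ‖A t ⟨x, ht⟩ - A s ⟨x, hs⟩‖ ≤
      C * |t - s| ^ β * ‖A τ ⟨x, hτ⟩‖ ^ α * ‖x‖ ^ (1 - α)

/-- `u` is a classical solution of `u'(t) = A(t) u(t)`, `t ≥ s`, `u(s) = x`: it is `C¹` on
`[s, ∞)` (one-sided derivative at `s`), takes values in the domains and solves the equation. -/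
structure IsClassicalSolution (A : ℝ → X →ₗ.[ℂ] X) (s : ℝ) (x : X) (u : ℝ → X) : Prop where
  init : u s = x
  contDiffOn : ContDiffOn ℝ 1 u (Ici s)
  mem_domain : ∀ t : ℝ, s ≤ t → u t ∈ (A t).domain
  hasDeriv : ∀ (t : ℝ) (ht : s ≤ t),
    HasDerivWithinAt u (A t ⟨u t, mem_domain t ht⟩) (Ici s) t

/-- Exponentially bounded evolution family `(U t s)_{t ≥ s}`; values for `t < s` are irrelevant. -/
structure IsEvolutionFamily (U : ℝ → ℝ → X →L[ℂ] X) : Prop where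
  comp : ∀ t r s : ℝ, s ≤ r → r ≤ t → (U t r).comp (U r s) = U t s
  refl : ∀ t : ℝ, U t t = ContinuousLinearMap.id ℂ X
  continuousOn : ∀ x : X, ContinuousOn (fun p : ℝ × ℝ => U p.1 p.2 x) {p | p.2 ≤ p.1}
  exp_bound : ∃ ω : ℝ, ∀ t s : ℝ, s ≤ t → ‖U t s‖ ≤ Real.exp (ω * (t - s))

/-- `U` is an evolution family solving the Cauchy problem for `(A t)`: for each `s`, the initial
values `y` for which `t ↦ U t s y` is a classical solution on `[s, ∞)` are dense. -/
def SolvesNCP (A : ℝ → X →ₗ.[ℂ] X) (U : ℝ → ℝ → X →L[ℂ] X) : Prop :=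
  IsEvolutionFamily U ∧
    ∀ s : ℝ, Dense {y : X | IsClassicalSolution A s y (fun t => U t s y)}

/-- The time-ordered product `F (M - 1) ∘ ⋯ ∘ F 1 ∘ F 0`. -/
def timeOrderedProd (F : ℕ → X →L[ℂ] X) : ℕ → X →L[ℂ] X
  | 0 => ContinuousLinearMap.id ℂ X
  | n + 1 => (F n).comp (timeOrderedProd F n)

/-- The freezing-time approximation `∏_{k=0}^{M-1} e^{Δt A(k Δt)}` with `M` steps of size `Δt`. -/
noncomputable def freezingProd (A : ℝ → X →ₗ.[ℂ] X) (Δt : ℝ) (M : ℕ) : X →L[ℂ] X :=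
  timeOrderedProd (fun k => expSemigroup (A (k * Δt)) Δt) M

end NCP

namespace NCP

variable {X : Type*} [NormedAddCommGroup X] [NormedSpace ℂ X]

/-! The global bound follows from a local error of order `h ^ (1 + β - α)` for one step of size `h`
(`norm_sub_expSemigroup_le`). All factors are bounded by exponentials, so `M` such errors accumulate
to a multiple of `M * Δt ^ (1 + β - α) = T * Δt ^ (β - α)` (`norm_sub_timeOrderedProd_le`).

For the local error, comparing `U (s + h) s` with `e^{hA(s)}` directly would call for smoothing of
`U`, which is not assumed. Smoothing is known for the frozen semigroups: `‖e^{τA(t)} A(t) y‖ ≤ (G /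
τ) ‖y‖` uniformly in `t`, obtained from the half-plane resolvent bound by Fourier inversion
(`norm_apply_generator_le`). So a third object is inserted: the frozen product on a much finer grid
of mesh `d = h / n`. It differs from `e^{hA(s)}` by `O(h ^ (1 + β - α))` uniformly in `n`, because
the defect at distance `a` from `s` is of size `a ^ β * a ^ (-α)`. Along a classical solution it
differs from `U` by `O(d ^ β)`, with a constant depending on the solution, and this vanishes as `n →
∞`. Density of the classical initial values then gives the operator norm bound. -/

theorem isResolventAt_resolvent {A : X →ₗ.[ℂ] X} {z : ℂ} (hz : z ∈ resolventSet A) :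
    IsResolventAt A z (resolvent A z) := by
  have h : ∃ R : X →L[ℂ] X, IsResolventAt A z R := hz
  rw [resolvent, dif_pos h]
  exact h.choose_spec

theorem expSemigroup_spec {A : X →ₗ.[ℂ] X} (h : Generates A) :
    IsC0Semigroup (expSemigroup A) ∧ IsGenerator (expSemigroup A) A := by
  rw [expSemigroup, dif_pos h]
  exact h.choose_spec

/-- Strongly convergent, eventually bounded operators map convergent families to convergent
families. -/
theorem tendsto_apply_of_bounded {ι : Type*} {l : Filter ι} {F : ι → X →L[ℂ] X} {v : ι → X}
    {B : ℝ} {x y : X} (hB : ∀ᶠ i in l, ‖F i‖ ≤ B) (hF : Tendsto (fun i => F i x) l (𝓝 y))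
    (hv : Tendsto v l (𝓝 x)) : Tendsto (fun i => F i (v i)) l (𝓝 y) := by
  have h : Tendsto (fun i => F i (v i - x)) l (𝓝 0) := by
    have h0 : Tendsto (fun i => B * ‖v i - x‖) l (𝓝 0) := by
      simpa using ((hv.sub_const x).norm).const_mul B
    refine squeeze_zero_norm' ?_ h0
    filter_upwards [hB] with i hi
    exact (F i).le_of_opNorm_le hi _
  simpa using h.add hF

/-! ### Differential calculus for strongly continuous semigroups -/

namespace IsC0Semigroup

variable {S : ℝ → X →L[ℂ] X} {A : X →ₗ.[ℂ] X}

/-- A semigroup maps the domain of its generator to itself and commutes with the generator. -/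
theorem generator_apply (hS : IsC0Semigroup S) (hA : IsGenerator S A) {t : ℝ} (ht : 0 ≤ t)
    (x : A.domain) : ∃ h : S t x ∈ A.domain, A ⟨S t x, h⟩ = S t (A x) := by
  rw [hA]
  have hx := (hA x (A x)).1 ⟨x.2, rfl⟩
  refine (((S t).continuous.tendsto _).comp hx).congr' ?_
  filter_upwards [self_mem_nhdsWithin] with h (hh : 0 < h)
  have e : S t (S h x) = S h (S t x) := by
    rw [← ContinuousLinearMap.comp_apply, ← hS.add t h ht hh.le, add_comm, hS.add h t hh.le ht]
    rfl
  simp [e, map_sub]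

theorem hasDerivWithinAt_apply (hS : IsC0Semigroup S) (hA : IsGenerator S A) {t : ℝ}
    (ht : 0 ≤ t) (x : A.domain) :
    HasDerivWithinAt (fun τ => S τ x) (S t (A x)) (Ici t) t := by
  rw [← hasDerivWithinAt_Ioi_iff_Ici, hasDerivWithinAt_iff_tendsto_slope' (by simp)]
  have hx := ((S t).continuous.tendsto _).comp ((hA x (A x)).1 ⟨x.2, rfl⟩)
  have hs : Tendsto (fun r : ℝ => r - t) (𝓝[>] t) (𝓝[>] 0) := by
    refine tendsto_nhdsWithin_iff.2 ⟨?_, ?_⟩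
    · have : Tendsto (fun r : ℝ => r - t) (𝓝 t) (𝓝 0) := by
        simpa using (continuous_sub_right t).tendsto t
      exact this.mono_left nhdsWithin_le_nhds
    · filter_upwards [self_mem_nhdsWithin] with r (hr : t < r)
      exact sub_pos.2 hr
  refine (hx.comp hs).congr' ?_
  filter_upwards [self_mem_nhdsWithin] with r (hr : t < r)
  have e : S r x = S t (S (r - t) x) := by
    rw [← ContinuousLinearMap.comp_apply, ← hS.add t (r - t) ht (by linarith)]
    congr 2
    ring
  simp [slope_def_module, e]

/-- Right derivative of `q ↦ S (d - q) (u q)`. -/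
theorem hasDerivWithinAt_sub_apply (hS : IsC0Semigroup S) (hA : IsGenerator S A) {d q B : ℝ}
    (hB : ∀ τ ∈ Icc 0 d, ‖S τ‖ ≤ B) (hq : q ∈ Ico 0 d) {u : ℝ → X} {u' : X}
    (hu : HasDerivWithinAt u u' (Ici q) q) (hm : u q ∈ A.domain) :
    HasDerivWithinAt (fun r => S (d - r) (u r)) (S (d - q) (u' - A ⟨u q, hm⟩)) (Ici q) q := by
  -- The slope of `r ↦ S (d - r) (u r)` at `q` is `S (d - r)` applied to the slope of `r ↦ u r - S
  -- (r - q) (u q)`. Only the right derivative of the orbit at time `0` is needed, and bounded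
  -- strong convergence passes to the limit.
  have hd : HasDerivWithinAt (fun r => u r - S (r - q) (u q)) (u' - A ⟨u q, hm⟩) (Ici q) q := by
    refine hu.sub ?_
    have h0 := hS.hasDerivWithinAt_apply hA le_rfl ⟨u q, hm⟩
    have h1 : HasDerivWithinAt (fun r : ℝ => r - q) 1 (Ici q) q :=
      (hasDerivWithinAt_id q _).sub_const q
    have h2 := HasDerivWithinAt.scomp_of_eq q h0 h1
      (fun r (hr : q ≤ r) => by simpa using hr) (by simp)
    simpa [hS.zero, Function.comp_def] using h2
  rw [← hasDerivWithinAt_Ioi_iff_Ici, hasDerivWithinAt_iff_tendsto_slope' (by simp)] at hd ⊢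
  have hev : ∀ᶠ r in 𝓝[>] q, r ∈ Ioo q d := Ioo_mem_nhdsGT hq.2
  have hB' : ∀ᶠ r in 𝓝[>] q, ‖S (d - r)‖ ≤ B := by
    filter_upwards [hev] with r hr
    exact hB _ ⟨by linarith [hr.2], by linarith [hr.1, hq.1]⟩
  have hc : Tendsto (fun r => S (d - r) (u' - A ⟨u q, hm⟩)) (𝓝[>] q)
      (𝓝 (S (d - q) (u' - A ⟨u q, hm⟩))) := by
    have h1 := hS.continuousOn (u' - A ⟨u q, hm⟩) (d - q) (by simpa using hq.2.le)
    refine h1.tendsto.comp (tendsto_nhdsWithin_iff.2 ⟨?_, ?_⟩)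
    · exact ((continuous_sub_left d).tendsto q).mono_left nhdsWithin_le_nhds
    · filter_upwards [hev] with r hr
      simpa using hr.2.le
  refine (tendsto_apply_of_bounded hB' hc hd).congr' ?_
  filter_upwards [hev] with r hr
  have e : S (d - q) (u q) = S (d - r) (S (r - q) (u q)) := by
    rw [← ContinuousLinearMap.comp_apply, ← hS.add (d - r) (r - q) (by linarith [hr.2])
      (by linarith [hr.1])]
    congr 2
    ring
  simp [slope_def_module, e, hS.zero]

/-- Comparison of a function `u` with the semigroup in terms of the defect `u' - A u`. -/
theorem norm_sub_apply_le (hS : IsC0Semigroup S) (hA : IsGenerator S A) {d B c : ℝ}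
    (hd : 0 ≤ d) (hB : ∀ τ ∈ Icc 0 d, ‖S τ‖ ≤ B) {u u' : ℝ → X}
    (hc : ContinuousOn u (Icc 0 d))
    (hu : ∀ q ∈ Ico 0 d, HasDerivWithinAt u (u' q) (Ici q) q)
    (hm : ∀ q ∈ Ico 0 d, ∃ h : u q ∈ A.domain, ‖u' q - A ⟨u q, h⟩‖ ≤ c) :
    ‖u d - S d (u 0)‖ ≤ B * c * d := by
  choose hm hle using hm
  have hB0 : 0 ≤ B := (norm_nonneg _).trans (hB 0 ⟨le_rfl, hd⟩)
  have hcont : ContinuousOn (fun r => S (d - r) (u r)) (Icc 0 d) := by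
    intro q hq
    refine tendsto_apply_of_bounded (B := B) ?_ ?_ (hc q hq)
    · filter_upwards [self_mem_nhdsWithin] with r hr
      exact hB _ ⟨by linarith [hr.2], by linarith [hr.1]⟩
    · have h1 := hS.continuousOn (u q) (d - q) (by simpa using hq.2)
      refine h1.tendsto.comp (tendsto_nhdsWithin_iff.2 ⟨?_, ?_⟩)
      · exact ((continuous_sub_left d).tendsto q).mono_left nhdsWithin_le_nhds
      · filter_upwards [self_mem_nhdsWithin] with r hr
        simpa using hr.2
  let f' : ℝ → X := fun q =>
    if h : q ∈ Ico 0 d then S (d - q) (u' q - A ⟨u q, hm q h⟩) else 0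
  have hder : ∀ q ∈ Ico 0 d, HasDerivWithinAt (fun r => S (d - r) (u r)) (f' q) (Ici q) q := by
    intro q hq
    simp only [f', dif_pos hq]
    exact hS.hasDerivWithinAt_sub_apply hA hB hq (hu q hq) (hm q hq)
  have hbd : ∀ q ∈ Ico 0 d, ‖f' q‖ ≤ B * c := by
    intro q hq
    simp only [f', dif_pos hq]
    exact ((S (d - q)).le_of_opNorm_le_of_le
      (hB _ ⟨by linarith [hq.2], by linarith [hq.1]⟩) (hle q hq))
  have := norm_image_sub_le_of_norm_deriv_right_le_segment hcont hder hbd d ⟨hd, le_rfl⟩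
  simpa [hS.zero] using this

end IsC0Semigroup

/-! ### Stability of time-ordered products -/

/-- Discrete Gronwall-type comparison of a sequence with a time-ordered product. -/
theorem norm_sub_timeOrderedProd_le {F : ℕ → X →L[ℂ] X} {v : ℕ → X} {a ε : ℝ} (ha : 0 ≤ a)
    (hε : 0 ≤ ε) {n : ℕ} (hF : ∀ k < n, ‖F k‖ ≤ Real.exp a)
    (hv : ∀ k < n, ‖v (k + 1) - F k (v k)‖ ≤ ε) :
    ‖v n - timeOrderedProd F n (v 0)‖ ≤ Real.exp (n * a) * (n * ε) := by
  induction n with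
  | zero => simp [timeOrderedProd]
  | succ n ih =>
    have h1 := ih (fun k hk => hF k (hk.trans n.lt_succ_self))
      (fun k hk => hv k (hk.trans n.lt_succ_self))
    have h2 := hv n n.lt_succ_self
    have h3 : ‖F n (v n - timeOrderedProd F n (v 0))‖ ≤
        Real.exp a * (Real.exp (n * a) * (n * ε)) :=
      (F n).le_of_opNorm_le_of_le (hF n n.lt_succ_self) h1
    have e : v (n + 1) - timeOrderedProd F (n + 1) (v 0) =
        (v (n + 1) - F n (v n)) + F n (v n - timeOrderedProd F n (v 0)) := by
      simp [timeOrderedProd]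
    have h4 : (1 : ℝ) ≤ Real.exp ((n + 1) * a) := Real.one_le_exp (by positivity)
    have h5 : Real.exp ((n + 1) * a) = Real.exp a * Real.exp (n * a) := by
      rw [← Real.exp_add]; ring_nf
    rw [e]
    refine (norm_add_le_of_le h2 h3).trans ?_
    push_cast
    calc ε + Real.exp a * (Real.exp (n * a) * (n * ε))
        = ε * 1 + Real.exp ((n + 1) * a) * (n * ε) := by rw [h5]; ring
      _ ≤ ε * Real.exp ((n + 1) * a) + Real.exp ((n + 1) * a) * (n * ε) := by gcongr
      _ = _ := by ring

/-! ### Laplace transforms and powers of the resolvent -/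

/-- The integrand `tⁿ e^{-zt} S(t) x` of the `n`-th derivative of the Laplace transform of `S`. -/
noncomputable def laplaceIntegrand (S : ℝ → X →L[ℂ] X) (n : ℕ) (z : ℂ) (x : X) (t : ℝ) : X :=
  ((t : ℂ) ^ n * Complex.exp (-z * t)) • S t x

section Laplace

variable {S : ℝ → X →L[ℂ] X} {A : X →ₗ.[ℂ] X} {ω : ℝ} {z : ℂ}

theorem norm_laplaceIntegrand_le (hb : ∀ t, 0 ≤ t → ‖S t‖ ≤ Real.exp (ω * t)) (n : ℕ) (x : X)
    {t : ℝ} (ht : 0 ≤ t) :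
    ‖laplaceIntegrand S n z x t‖ ≤ t ^ (n : ℝ) * Real.exp (-(z.re - ω) * t) * ‖x‖ := by
  have h1 : ‖(t : ℂ) ^ n * Complex.exp (-z * t)‖ = t ^ n * Real.exp (-z.re * t) := by
    rw [norm_mul, norm_pow, Complex.norm_real, Real.norm_of_nonneg ht, Complex.norm_exp]
    simp
  rw [laplaceIntegrand, norm_smul, h1, Real.rpow_natCast]
  calc t ^ n * Real.exp (-z.re * t) * ‖S t x‖
      ≤ t ^ n * Real.exp (-z.re * t) * (Real.exp (ω * t) * ‖x‖) := by
        gcongr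
        exact (S t).le_of_opNorm_le (hb t ht) x
    _ = t ^ n * (Real.exp (-z.re * t) * Real.exp (ω * t)) * ‖x‖ := by ring
    _ = _ := by rw [← Real.exp_add]; ring_nf

theorem continuousOn_laplaceIntegrand (hS : IsC0Semigroup S) (n : ℕ) (x : X) :
    ContinuousOn (laplaceIntegrand S n z x) (Ici 0) := by
  refine ContinuousOn.smul (Continuous.continuousOn ?_) (hS.continuousOn x)
  fun_prop

theorem integrableOn_laplaceIntegrand (hS : IsC0Semigroup S)
    (hb : ∀ t, 0 ≤ t → ‖S t‖ ≤ Real.exp (ω * t)) (hz : ω < z.re) (n : ℕ) (x : X) :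
    MeasureTheory.IntegrableOn (laplaceIntegrand S n z x) (Ioi 0) := by
  have h := (integrableOn_rpow_mul_exp_neg_mul_rpow (p := 1) (s := n) (b := z.re - ω)
    (by linarith [n.cast_nonneg (α := ℝ)]) one_pos (sub_pos.2 hz)).mul_const ‖x‖
  refine MeasureTheory.Integrable.mono' h ?_ ?_
  · exact ((continuousOn_laplaceIntegrand hS n x).mono Ioi_subset_Ici_self).aestronglyMeasurable
      measurableSet_Ioi
  · filter_upwards [MeasureTheory.ae_restrict_mem measurableSet_Ioi] with t (ht : 0 < t)
    simpa using norm_laplaceIntegrand_le (z := z) hb n x ht.le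

theorem tendsto_laplaceIntegrand (hb : ∀ t, 0 ≤ t → ‖S t‖ ≤ Real.exp (ω * t)) (hz : ω < z.re)
    (n : ℕ) (x : X) : Tendsto (laplaceIntegrand S n z x) atTop (𝓝 0) := by
  have h := (tendsto_rpow_mul_exp_neg_mul_atTop_nhds_zero n (z.re - ω)
    (sub_pos.2 hz)).mul_const ‖x‖
  rw [zero_mul] at h
  refine squeeze_zero_norm' ?_ h
  filter_upwards [eventually_ge_atTop 0] with t ht
  exact norm_laplaceIntegrand_le hb n x ht

/-- Integration by parts: differentiate `t ^ n * e^{-zt} S(t) R x`, use `A R x = z R x - x`, and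
integrate over the half-line. The boundary term at `0` survives only for `n = 0`, where the factor
`n` also makes the truncated `n - 1` harmless. -/
theorem integral_laplaceIntegrand [CompleteSpace X] (hS : IsC0Semigroup S)
    (hA : IsGenerator S A)
    (hb : ∀ t, 0 ≤ t → ‖S t‖ ≤ Real.exp (ω * t)) (hz : ω < z.re) {R : X →L[ℂ] X}
    (hR : IsResolventAt A z R) (n : ℕ) (x : X) :
    ∫ t in Ioi 0, laplaceIntegrand S n z x t =
      (n : ℂ) • (∫ t in Ioi 0, laplaceIntegrand S (n - 1) z (R x) t) + (0 : ℂ) ^ n • R x := by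
  obtain ⟨hm, hx⟩ := hR.1 x
  have hder : ∀ t : ℝ, 0 ≤ t → HasDerivWithinAt (laplaceIntegrand S n z (R x))
      ((n : ℂ) • laplaceIntegrand S (n - 1) z (R x) t - laplaceIntegrand S n z x t)
      (Ioi t) t := by
    intro t ht
    have h1 := (hS.hasDerivWithinAt_apply hA ht ⟨R x, hm⟩).mono Ioi_subset_Ici_self
    have h2 : HasDerivAt (fun w : ℂ => w ^ n * Complex.exp (-z * w))
        (n * (t : ℂ) ^ (n - 1) * Complex.exp (-z * t) +
          (t : ℂ) ^ n * (Complex.exp (-z * t) * (-z * 1))) (t : ℂ) :=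
      (hasDerivAt_pow n _).mul ((hasDerivAt_id _).const_mul (-z)).cexp
    have h3 := (h2.comp_ofReal.hasDerivWithinAt (s := Ioi t)).smul h1
    have e : A ⟨R x, hm⟩ = z • R x - x := by
      rw [eq_sub_iff_add_eq, add_comm]
      exact (sub_eq_iff_eq_add.1 hx).symm
    refine h3.congr_deriv ?_
    rw [e]
    simp only [laplaceIntegrand, map_sub, map_smul]
    module
  have hI1 := (integrableOn_laplaceIntegrand hS hb hz (n - 1) (R x)).smul (n : ℂ)
  have hI2 := integrableOn_laplaceIntegrand hS hb hz n x
  have hI := hI1.sub hI2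
  have hlim := MeasureTheory.intervalIntegral_tendsto_integral_Ioi 0 hI (b := fun b : ℝ => b) tendsto_id
  have hlim' := (tendsto_laplaceIntegrand hb hz n (R x)).sub_const
    (laplaceIntegrand S n z (R x) 0)
  have heq := tendsto_nhds_unique hlim (hlim'.congr' (by
    filter_upwards [eventually_ge_atTop 0] with b hb0
    symm
    refine intervalIntegral.integral_eq_sub_of_hasDeriv_right ?_ ?_ ?_
    · exact (continuousOn_laplaceIntegrand hS n (R x)).mono (by
        intro t ht
        rw [uIcc_of_le hb0] at ht
        exact ht.1)
    · intro t ht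
      exact hder t (by simpa [hb0] using ht.1.le)
    · rw [intervalIntegrable_iff_integrableOn_Ioc_of_le hb0]
      exact MeasureTheory.IntegrableOn.mono_set (by exact hI) Ioc_subset_Ioi_self))
  have e1 : (∫ t in Ioi 0, ((n : ℂ) • laplaceIntegrand S (n - 1) z (R x) -
      laplaceIntegrand S n z x) t) = (n : ℂ) • (∫ t in Ioi 0, laplaceIntegrand S (n - 1) z (R x) t)
        - ∫ t in Ioi 0, laplaceIntegrand S n z x t := by
    rw [← MeasureTheory.integral_smul, ← MeasureTheory.integral_sub (by exact hI1) hI2]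
    rfl
  have e0 : laplaceIntegrand S n z (R x) 0 = (0 : ℂ) ^ n • R x := by
    simp [laplaceIntegrand, hS.zero]
  rw [e1, e0] at heq
  rw [zero_sub, sub_eq_iff_eq_add] at heq
  rw [heq]
  abel

/-- The weight `t ^ 2` supplies three resolvents: one absorbs the generator in `R A y`, the other
two give decay `|z|⁻²`, integrable along vertical lines. -/
theorem integral_laplaceIntegrand_two [CompleteSpace X] (hS : IsC0Semigroup S)
    (hA : IsGenerator S A)
    (hb : ∀ t, 0 ≤ t → ‖S t‖ ≤ Real.exp (ω * t)) (hz : ω < z.re) {R : X →L[ℂ] X}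
    (hR : IsResolventAt A z R) (x : X) :
    ∫ t in Ioi 0, laplaceIntegrand S 2 z x t = (2 : ℂ) • R (R (R x)) := by
  rw [integral_laplaceIntegrand hS hA hb hz hR, integral_laplaceIntegrand hS hA hb hz hR,
    integral_laplaceIntegrand hS hA hb hz hR]
  simp

end Laplace

/-! ### Smoothing by Fourier inversion -/

open FourierTransform in
/-- Smoothing estimate for a semigroup whose generator has resolvents `O(1/|z|)` on a half-plane. -/
theorem norm_apply_generator_le [CompleteSpace X] {S : ℝ → X →L[ℂ] X} {A : X →ₗ.[ℂ] X} {ω K : ℝ}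
    (hS : IsC0Semigroup S) (hA : IsGenerator S A) (hω : 0 ≤ ω) (hK : 0 ≤ K)
    (hb : ∀ t, 0 ≤ t → ‖S t‖ ≤ Real.exp (ω * t))
    (hR : ∀ z : ℂ, ω < z.re → ∃ R : X →L[ℂ] X, IsResolventAt A z R ∧ ‖R‖ ≤ K / ‖z‖)
    {t : ℝ} (ht : 0 < t) (y : A.domain) :
    ‖S t (A y)‖ ≤ Real.exp (1 + ω * t) * ((K + 1) * K ^ 2) / t * ‖(y : X)‖ := by
  -- On this vertical line the exponential weight at time `t` is `e^{-(1 + ω t)}`, while `c⁻¹ ≤ t`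
  -- yields the power of `t`.
  set c : ℝ := t⁻¹ + ω with hc
  have htinv : 0 < t⁻¹ := inv_pos.2 ht
  have hc0 : 0 < c := by positivity
  have hcω : ω < c := by linarith
  -- Extension by zero to `r < 0`; it is continuous because the weight `r ^ 2` vanishes at `0`.
  let f : ℝ → X := fun r => laplaceIntegrand S 2 c (A y) (max r 0)
  have hf_pos : ∀ r : ℝ, 0 ≤ r → f r = laplaceIntegrand S 2 c (A y) r := by
    intro r hr; simp [f, max_eq_left hr]
  have hf_neg : ∀ r : ℝ, r ≤ 0 → f r = 0 := by
    intro r hr; simp [f, max_eq_right hr, laplaceIntegrand]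
  have hfc : Continuous f :=
    (continuousOn_laplaceIntegrand hS 2 (A y)).comp_continuous (by fun_prop) (by simp)
  have hfi : MeasureTheory.Integrable f := by
    refine (MeasureTheory.integrableOn_iff_integrable_of_support_subset (s := Ioi 0) ?_).1 ?_
    · intro r hr
      by_contra h
      exact hr (hf_neg r (not_lt.1 h))
    · refine (integrableOn_laplaceIntegrand hS hb (z := (c : ℂ)) (by simpa using hcω) 2
        (A y)).congr_fun (fun r hr => (hf_pos r (le_of_lt hr)).symm) measurableSet_Ioi
  have hFT : ∀ ξ : ℝ, ∀ R : X →L[ℂ] X, IsResolventAt A (c + 2 * Real.pi * ξ * Complex.I) R →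
      𝓕 f ξ = (2 : ℂ) • R (R (R (A y))) := by
    intro ξ R hRξ
    rw [Real.fourier_real_eq_integral_exp_smul,
      ← integral_laplaceIntegrand_two hS hA hb (by simpa using hcω) hRξ,
      ← MeasureTheory.setIntegral_eq_integral_of_forall_compl_eq_zero (s := Ioi 0)]
    · refine MeasureTheory.setIntegral_congr_fun measurableSet_Ioi fun r (hr : 0 < r) => ?_
      simp only [hf_pos r hr.le, laplaceIntegrand, smul_smul]
      congr 1
      rw [mul_left_comm, ← Complex.exp_add]
      congr 2
      push_cast
      ring
    · intro r hr
      rw [hf_neg r (not_lt.1 hr), smul_zero]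
  set D : ℝ := 2 * ((K + 1) * K ^ 2) * ‖(y : X)‖ with hD
  have hbd : ∀ ξ : ℝ, ‖𝓕 f ξ‖ ≤ D / c ^ 2 * (1 + (2 * Real.pi / c * ξ) ^ 2)⁻¹ := by
    intro ξ
    set z : ℂ := c + 2 * Real.pi * ξ * Complex.I with hz
    obtain ⟨R, hRz, hRK⟩ := hR z (by simpa [hz] using hcω)
    have hnz : ‖z‖ ^ 2 = c ^ 2 + (2 * Real.pi * ξ) ^ 2 := by
      rw [Complex.sq_norm, Complex.normSq_apply]
      simp [hz]
      ring
    have hzpos : 0 < ‖z‖ := by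
      have : 0 < ‖z‖ ^ 2 := by rw [hnz]; positivity
      exact lt_of_le_of_ne (norm_nonneg z) fun h => by simp [← h] at this
    -- The unbounded factor disappears here: `‖R A y‖` is bounded by `(K + 1) ‖y‖`, uniformly in
    -- `z`.
    have e : R (A y) = z • R y - y := by
      have := hRz.2 y
      rw [map_sub, map_smul] at this
      rw [eq_sub_iff_add_eq, add_comm]
      exact (sub_eq_iff_eq_add.1 this).symm
    have h1 : ‖R (A y)‖ ≤ (K + 1) * ‖(y : X)‖ := by
      rw [e]
      refine (norm_sub_le _ _).trans ?_
      rw [norm_smul]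
      have := R.le_of_opNorm_le hRK (y : X)
      calc ‖z‖ * ‖R y‖ + ‖(y : X)‖ ≤ ‖z‖ * (K / ‖z‖ * ‖(y : X)‖) + ‖(y : X)‖ := by gcongr
        _ = _ := by field_simp
    have h2 := R.le_of_opNorm_le_of_le hRK (R.le_of_opNorm_le_of_le hRK h1)
    rw [hFT ξ R hRz, norm_smul]
    calc ‖(2 : ℂ)‖ * ‖R (R (R (A y)))‖
        ≤ 2 * (K / ‖z‖ * (K / ‖z‖ * ((K + 1) * ‖(y : X)‖))) := by
          rw [Complex.norm_two]; gcongr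
      _ = D / ‖z‖ ^ 2 := by rw [hD]; field_simp
      _ = _ := by rw [hnz]; field_simp
  have hint : MeasureTheory.Integrable
      (fun ξ : ℝ => D / c ^ 2 * (1 + (2 * Real.pi / c * ξ) ^ 2)⁻¹) :=
    (integrable_inv_one_add_sq.comp_mul_left' (by positivity)).const_mul _
  have hFc : Continuous (𝓕 f) :=
    VectorFourier.fourierIntegral_continuous Real.continuous_fourierChar
      (by exact continuous_inner) hfi
  have hFi : MeasureTheory.Integrable (𝓕 f) :=
    hint.mono' hFc.aestronglyMeasurable (.of_forall hbd)
  have hinv : f t = 𝓕⁻ (𝓕 f) t := by rw [hfc.fourierInv_fourier_eq hfi hFi]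
  have hval : ∫ ξ : ℝ, D / c ^ 2 * (1 + (2 * Real.pi / c * ξ) ^ 2)⁻¹ = D / (2 * c) := by
    rw [MeasureTheory.integral_const_mul,
      MeasureTheory.Measure.integral_comp_mul_left (fun x : ℝ => (1 + x ^ 2)⁻¹),
      integral_univ_inv_one_add_sq, abs_of_pos (by positivity)]
    simp only [smul_eq_mul]
    field_simp
  have hle : ‖f t‖ ≤ D / (2 * c) := by
    rw [hinv, Real.fourierInv_eq', ← hval]
    refine MeasureTheory.norm_integral_le_of_norm_le hint (.of_forall fun ξ => ?_)
    rw [norm_smul]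
    convert hbd ξ using 1
    rw [Complex.norm_exp]
    simp
  have hft : ‖f t‖ = t ^ 2 * Real.exp (-(1 + ω * t)) * ‖S t (A y)‖ := by
    rw [hf_pos t ht.le, laplaceIntegrand, norm_smul, norm_mul, norm_pow, Complex.norm_real,
      Real.norm_of_nonneg ht.le, Complex.norm_exp]
    have : (-(c : ℂ) * t).re = -(1 + ω * t) := by
      rw [← Complex.ofReal_neg, ← Complex.ofReal_mul, Complex.ofReal_re, hc]
      field_simp
    rw [this]
  have hcle : D / (2 * c) ≤ D / 2 * t := by
    rw [div_mul_eq_div_div, div_eq_mul_inv _ c]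
    have hD0 : 0 ≤ D := by positivity
    have : c⁻¹ ≤ t := inv_le_of_inv_le₀ ht (by linarith)
    gcongr
  rw [hft] at hle
  have hexp : Real.exp (1 + ω * t) * Real.exp (-(1 + ω * t)) = 1 := by
    rw [← Real.exp_add]; simp
  have hfin : t ^ 2 * ‖S t (A y)‖ ≤ Real.exp (1 + ω * t) * (D / 2 * t) := by
    calc t ^ 2 * ‖S t (A y)‖
        = Real.exp (1 + ω * t) * (t ^ 2 * Real.exp (-(1 + ω * t)) * ‖S t (A y)‖) := by
          linear_combination (-(t ^ 2 * ‖S t (A y)‖)) * hexp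
      _ ≤ _ := by
          have := hle.trans hcle
          gcongr
  rw [div_mul_eq_mul_div, le_div_iff₀ ht]
  refine le_of_mul_le_mul_left ?_ ht
  calc t * (‖S t (A y)‖ * t) = t ^ 2 * ‖S t (A y)‖ := by ring
    _ ≤ _ := hfin
    _ = _ := by rw [hD]; ring

/-! ### Reduction to `α ≤ 1` -/

/-- The Hölder condition is only informative for `α ≤ 1`: for `α > 1` it forces `t ↦ A t x` to be
constant. -/
theorem HolderCondition.exists_le_one {A : ℝ → X →ₗ.[ℂ] X} {α β : ℝ}
    (h : HolderCondition A α β) (hdom : ∀ s t : ℝ, (A s).domain = (A t).domain) :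
    ∃ α' β' : ℝ, α' ≤ 1 ∧ β' - α' = β - α ∧ HolderCondition A α' β' := by
  rcases le_or_gt α 1 with h1 | h1
  · exact ⟨α, β, h1, rfl, h⟩
  obtain ⟨hα, hαβ, C, hC⟩ := h
  refine ⟨0, β - α, zero_le_one, by ring, le_rfl, sub_pos.2 hαβ, 0, ?_⟩
  intro s τ t hsτ hτt x hs hτ ht
  have hx : ∀ r, x ∈ (A r).domain := fun r => hdom s r ▸ hs
  let g : ℝ → X := fun r => A r ⟨x, hx r⟩
  have hg : ∀ r, HasDerivAt g 0 r := by
    intro r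
    -- Taking the intermediate time equal to `r` keeps this constant independent of `q`; then `β > α
    -- > 1` makes the increment `o(|q - r|)`.
    set N : ℝ := C * (‖A r ⟨x, hx r⟩‖ ^ α * ‖x‖ ^ (1 - α))
    have hbd : ∀ q, ‖g q - g r‖ ≤ N * |q - r| ^ β := by
      intro q
      rcases le_total r q with hrq | hrq
      · refine (hC r r q le_rfl hrq x (hx r) (hx r) (hx q)).trans_eq ?_
        ring
      · rw [norm_sub_rev, abs_sub_comm]
        refine (hC q r r hrq le_rfl x (hx q) (hx r) (hx r)).trans_eq ?_
        ring
    rw [hasDerivAt_iff_isLittleO]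
    have hO : (fun q => g q - g r - (q - r) • (0 : X)) =O[𝓝 r] fun q => |q - r| ^ β := by
      refine Asymptotics.IsBigO.of_bound N (.of_forall fun q => ?_)
      rw [smul_zero, sub_zero, Real.norm_of_nonneg (Real.rpow_nonneg (abs_nonneg _) _)]
      exact hbd q
    refine hO.trans_isLittleO ?_
    have hlim : Tendsto (fun q : ℝ => |q - r| ^ (β - 1)) (𝓝 r) (𝓝 0) := by
      have h0 : Tendsto (fun q : ℝ => |q - r|) (𝓝 r) (𝓝 0) := by
        have : Continuous fun q : ℝ => |q - r| := by fun_prop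
        simpa using this.tendsto r
      have := h0.rpow_const (p := β - 1) (Or.inr (by linarith))
      rwa [Real.zero_rpow (by linarith)] at this
    refine Asymptotics.isLittleO_of_tendsto' ?_ ?_ |>.trans_isBigO
      (Asymptotics.isBigO_refl (fun q => q - r) _).norm_left
    · refine .of_forall fun q hq => ?_
      rw [show |q - r| = 0 from hq, Real.zero_rpow (by linarith)]
    · refine hlim.congr' (.of_forall fun q => ?_)
      rcases (abs_nonneg (q - r)).eq_or_lt with h0 | h0
      · simp only [Real.norm_eq_abs, ← h0]
        rw [Real.zero_rpow (by linarith), div_zero]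
      · simp only [Real.rpow_sub_one h0.ne', Real.norm_eq_abs]
  have hconst : g t = g s :=
    is_const_of_deriv_eq_zero (fun r => (hg r).differentiableAt) (fun r => (hg r).deriv) t s
  have : A t ⟨x, ht⟩ = A s ⟨x, hs⟩ := hconst
  simp [this]

theorem rpow_mul_rpow_one_sub {N α : ℝ} (hN : 0 ≤ N) (h0 : 0 ≤ α) (h1 : α ≤ 1) :
    N ^ α * N ^ (1 - α) = N := by
  rw [← Real.rpow_add_of_nonneg hN h0 (sub_nonneg.2 h1)]
  simp

/-! ### Local error through fine frozen products -/

/-- The time-ordered product of the semigroups frozen at `s, s + d, …, s + (n - 1) d` with steps of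
size `d` stays close to the semigroup frozen at `s`. -/
theorem norm_expSemigroup_sub_timeOrderedProd_le {A : ℝ → X →ₗ.[ℂ] X} (hA : Parabolic A)
    {α β C ω G T : ℝ} (hα : 0 ≤ α) (hα1 : α ≤ 1) (hαβ : α < β) (hC : 0 ≤ C)
    (hH : ∀ s τ t : ℝ, s ≤ τ → τ ≤ t → ∀ (x : X)
      (hs : x ∈ (A s).domain) (hτ : x ∈ (A τ).domain) (ht : x ∈ (A t).domain),
      ‖A t ⟨x, ht⟩ - A s ⟨x, hs⟩‖ ≤ C * |t - s| ^ β * ‖A τ ⟨x, hτ⟩‖ ^ α * ‖x‖ ^ (1 - α))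
    (hω : 0 ≤ ω) (hexp : ∀ t τ, 0 ≤ τ → ‖expSemigroup (A t) τ‖ ≤ Real.exp (ω * τ))
    (hGT : Real.exp (ω * T) ≤ G)
    (hG : ∀ t τ, 0 < τ → τ ≤ T → ∀ y : (A t).domain,
      ‖expSemigroup (A t) τ (A t y)‖ ≤ G / τ * ‖(y : X)‖)
    (s : ℝ) {d : ℝ} (hd : 0 < d) {n : ℕ} (hn : n * d ≤ T) (y : (A s).domain) :
    ‖expSemigroup (A s) (n * d) y -
        timeOrderedProd (fun k => expSemigroup (A (s + k * d)) d) n y‖ ≤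
      Real.exp (n * (ω * d)) *
        (n * (Real.exp (ω * d) * (C * G * (n * d) ^ (β - α) * ‖(y : X)‖) * d)) := by
  have hG0 : 0 ≤ G := (Real.exp_pos _).le.trans hGT
  obtain ⟨hS, hgen⟩ := expSemigroup_spec (hA.analytic s).1
  set S := expSemigroup (A s)
  have key := norm_sub_timeOrderedProd_le (X := X) (F := fun k => expSemigroup (A (s + k * d)) d)
    (v := fun k => S (k * d) y) (a := ω * d)
    (ε := Real.exp (ω * d) * (C * G * (n * d) ^ (β - α) * ‖(y : X)‖) * d) (n := n)
    (by positivity) (by positivity) (fun k _ => hexp _ _ hd.le) ?_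
  · simpa [hS.zero] using key
  intro k hk
  obtain ⟨hSk, hgenk⟩ := expSemigroup_spec (hA.analytic (s + k * d)).1
  have hkd : 0 ≤ k * d := by positivity
  have hkn : (k + 1) * d ≤ n * d := by
    have : (k : ℝ) + 1 ≤ n := by exact_mod_cast hk
    gcongr
  have hcont : ContinuousOn (fun q => S (k * d + q) y) (Icc 0 d) :=
    (hS.continuousOn (y : X)).comp (by fun_prop) fun q hq => by
      have := hq.1
      simp only [mem_Ici]
      positivity
  have hder : ∀ q ∈ Ico 0 d, HasDerivWithinAt (fun q => S (k * d + q) y)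
      (S (k * d + q) (A s y)) (Ici q) q := by
    intro q hq
    have h0 := hS.hasDerivWithinAt_apply hgen (add_nonneg hkd hq.1) y
    have h1 : HasDerivWithinAt (fun r : ℝ => k * d + r) 1 (Ici q) q :=
      (hasDerivWithinAt_id q _).const_add _
    simpa [Function.comp_def] using
      HasDerivWithinAt.scomp_of_eq q h0 h1 (fun r (hr : q ≤ r) => by simpa using hr) rfl
  have hB : ∀ τ ∈ Icc 0 d, ‖expSemigroup (A (s + k * d)) τ‖ ≤ Real.exp (ω * d) := by
    intro τ hτ
    refine (hexp _ _ hτ.1).trans (Real.exp_le_exp.2 ?_)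
    have := hτ.2
    gcongr
  have := hSk.norm_sub_apply_le hgenk hd.le hB (c := C * G * (n * d) ^ (β - α) * ‖(y : X)‖)
    hcont hder ?_
  · simpa [add_mul] using this
  intro q hq
  have hkq : 0 ≤ k * d + q := add_nonneg hkd hq.1
  have hkqT : k * d + q ≤ T := by linarith [hq.2]
  obtain ⟨hm, hAe⟩ := hS.generator_apply hgen hkq y
  have hm' : S (k * d + q) y ∈ (A (s + k * d)).domain := hA.domain_eq s _ ▸ hm
  refine ⟨hm', ?_⟩
  rw [← hAe, norm_sub_rev]
  -- The intermediate time is the left endpoint `s`, so that the norm to control is that of `A s` on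
  -- its own orbit, where smoothing applies.
  refine (hH s s (s + k * d) le_rfl (by linarith) _ hm hm hm').trans ?_
  rw [add_sub_cancel_left, abs_of_nonneg hkd]
  -- Smoothing is singular at time `0`, but for `k = 0` the factor `(k * d) ^ β` vanishes since `β >
  -- 0`.
  rcases hkd.eq_or_lt with h0 | hpos
  · have e0 : (k * d) ^ β = 0 := by rw [← h0, Real.zero_rpow (by linarith)]
    rw [e0]
    simp only [mul_zero, zero_mul]
    positivity
  set a : ℝ := k * d
  have hAu : ‖A s ⟨S (a + q) y, hm⟩‖ ≤ a⁻¹ * (G * ‖(y : X)‖) := by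
    rw [hAe]
    refine (hG s (a + q) (by linarith [hq.1]) hkqT y).trans ?_
    rw [div_eq_inv_mul, mul_assoc]
    have := hq.1
    gcongr
    linarith
  have hu : ‖S (a + q) y‖ ≤ G * ‖(y : X)‖ := by
    refine (S (a + q)).le_of_opNorm_le ((hexp s _ hkq).trans (le_trans ?_ hGT)) _
    gcongr
  have hGy : 0 ≤ G * ‖(y : X)‖ := by positivity
  have h1α : 0 ≤ 1 - α := by linarith
  have hβα : 0 ≤ β - α := by linarith
  calc C * a ^ β * ‖A s ⟨S (a + q) y, hm⟩‖ ^ α * ‖S (a + q) y‖ ^ (1 - α)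
      ≤ C * a ^ β * (a⁻¹ * (G * ‖(y : X)‖)) ^ α * (G * ‖(y : X)‖) ^ (1 - α) := by gcongr
    _ = C * (a ^ β / a ^ α) * ((G * ‖(y : X)‖) ^ α * (G * ‖(y : X)‖) ^ (1 - α)) := by
        rw [Real.mul_rpow (by positivity) hGy, Real.inv_rpow hpos.le]
        ring
    _ = C * a ^ (β - α) * (G * ‖(y : X)‖) := by
        rw [rpow_mul_rpow_one_sub hGy hα hα1, Real.rpow_sub hpos]
    _ ≤ C * (n * d) ^ (β - α) * (G * ‖(y : X)‖) := by
        gcongr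
        linarith
    _ = _ := by ring

/-- The frozen products are consistent along classical solutions. -/
theorem exists_norm_sub_timeOrderedProd_le {A : ℝ → X →ₗ.[ℂ] X} (hA : Parabolic A)
    {α β C ω : ℝ} (hα : 0 ≤ α) (hα1 : α ≤ 1) (hαβ : α < β) (hC : 0 ≤ C)
    (hH : ∀ s τ t : ℝ, s ≤ τ → τ ≤ t → ∀ (x : X)
      (hs : x ∈ (A s).domain) (hτ : x ∈ (A τ).domain) (ht : x ∈ (A t).domain),
      ‖A t ⟨x, ht⟩ - A s ⟨x, hs⟩‖ ≤ C * |t - s| ^ β * ‖A τ ⟨x, hτ⟩‖ ^ α * ‖x‖ ^ (1 - α))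
    (hω : 0 ≤ ω) (hexp : ∀ t τ, 0 ≤ τ → ‖expSemigroup (A t) τ‖ ≤ Real.exp (ω * τ))
    {s h : ℝ} {y : X} {u : ℝ → X} (hu : IsClassicalSolution A s y u) :
    ∃ N : ℝ, 0 ≤ N ∧ ∀ (n : ℕ) (d : ℝ), 0 < d → n * d = h →
      ‖u (s + h) - timeOrderedProd (fun k => expSemigroup (A (s + k * d)) d) n y‖ ≤
        Real.exp (n * (ω * d)) * (n * (Real.exp (ω * d) * (C * d ^ β * N) * d)) := by
  have hcu := hu.contDiffOn.continuousOn
  -- Being `C¹` up to the initial time bounds `u' = A u` on the compact interval; no smoothing is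
  -- needed, at the price of a constant depending on `u`.
  have hcd := hu.contDiffOn.continuousOn_derivWithin (uniqueDiffOn_Ici s) le_rfl
  obtain ⟨N₁, hN₁⟩ := isCompact_Icc.exists_bound_of_continuousOn
    (hcu.mono (Icc_subset_Ici_self : Icc s (s + h) ⊆ Ici s))
  obtain ⟨N₂, hN₂⟩ := isCompact_Icc.exists_bound_of_continuousOn
    (hcd.mono (Icc_subset_Ici_self : Icc s (s + h) ⊆ Ici s))
  set N := max 0 (max N₁ N₂)
  have hN0 : 0 ≤ N := le_max_left _ _
  refine ⟨N, hN0, fun n d hd hnd => ?_⟩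
  have key := norm_sub_timeOrderedProd_le (X := X) (F := fun k => expSemigroup (A (s + k * d)) d)
    (v := fun k => u (s + k * d)) (a := ω * d)
    (ε := Real.exp (ω * d) * (C * d ^ β * N) * d) (n := n)
    (by positivity) (by positivity) (fun k _ => hexp _ _ hd.le) ?_
  · simpa [hnd, hu.init] using key
  intro k hk
  obtain ⟨hSk, hgenk⟩ := expSemigroup_spec (hA.analytic (s + k * d)).1
  have hkd : 0 ≤ k * d := by positivity
  have hkn : (k + 1) * d ≤ h := by
    have : (k : ℝ) + 1 ≤ n := by exact_mod_cast hk
    rw [← hnd]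
    gcongr
  have hcont : ContinuousOn (fun q => u (s + k * d + q)) (Icc 0 d) :=
    hcu.comp (by fun_prop) fun q hq => by
      have := hq.1
      simp only [mem_Ici]
      linarith
  have hder : ∀ q ∈ Ico 0 d, HasDerivWithinAt (fun q => u (s + k * d + q))
      (derivWithin u (Ici s) (s + k * d + q)) (Ici q) q := by
    intro q hq
    have hsq : s ≤ s + k * d + q := by linarith [hq.1]
    have h0 := (hu.hasDeriv _ hsq).differentiableWithinAt.hasDerivWithinAt
    have h1 : HasDerivWithinAt (fun r : ℝ => s + k * d + r) 1 (Ici q) q :=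
      (hasDerivWithinAt_id q _).const_add _
    simpa [Function.comp_def] using
      HasDerivWithinAt.scomp_of_eq q h0 h1
        (fun r (hr : q ≤ r) => by simp only [mem_Ici]; linarith) rfl
  have hB : ∀ τ ∈ Icc 0 d, ‖expSemigroup (A (s + k * d)) τ‖ ≤ Real.exp (ω * d) := by
    intro τ hτ
    refine (hexp _ _ hτ.1).trans (Real.exp_le_exp.2 ?_)
    have := hτ.2
    gcongr
  have := hSk.norm_sub_apply_le hgenk hd.le hB (c := C * d ^ β * N) hcont hder ?_
  · simpa [add_mul, add_assoc] using this
  intro q hq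
  have hq0 := hq.1
  have hsq : s ≤ s + k * d + q := by linarith
  have hmem : s + k * d + q ∈ Icc s (s + h) := ⟨hsq, by linarith [hq.2]⟩
  have hm := hu.mem_domain _ hsq
  have hm' : u (s + k * d + q) ∈ (A (s + k * d)).domain := hA.domain_eq _ _ ▸ hm
  have hder' := (hu.hasDeriv _ hsq).derivWithin (uniqueDiffOn_Ici s _ hsq)
  refine ⟨hm', ?_⟩
  have hN2 := hN₂ _ hmem
  rw [hder'] at hN2 ⊢
  -- Here the intermediate time is the right endpoint, where `A u` equals `u'`.
  refine (hH (s + k * d) _ (s + k * d + q) (by linarith) le_rfl _ hm' hm hm).trans ?_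
  rw [add_sub_cancel_left, abs_of_nonneg hq0]
  have h2 : ‖A (s + k * d + q) ⟨u (s + k * d + q), hm⟩‖ ≤ N :=
    hN2.trans ((le_max_right _ _).trans (le_max_right _ _))
  have h1 : ‖u (s + k * d + q)‖ ≤ N :=
    (hN₁ _ hmem).trans ((le_max_left _ _).trans (le_max_right _ _))
  have h1α : 0 ≤ 1 - α := by linarith
  have hβ : 0 ≤ β := by linarith
  calc C * q ^ β * ‖A (s + k * d + q) ⟨u (s + k * d + q), hm⟩‖ ^ α *
        ‖u (s + k * d + q)‖ ^ (1 - α)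
      ≤ C * d ^ β * N ^ α * N ^ (1 - α) := by
        have := hq.2.le
        gcongr
    _ = C * d ^ β * (N ^ α * N ^ (1 - α)) := by ring
    _ = _ := by rw [rpow_mul_rpow_one_sub hN0 hα hα1]

/-- Local error of the freezing approximation. -/
theorem norm_sub_expSemigroup_le {A : ℝ → X →ₗ.[ℂ] X} (hA : Parabolic A)
    {U : ℝ → ℝ → X →L[ℂ] X} (hU : SolvesNCP A U)
    {α β C ω G T : ℝ} (hα : 0 ≤ α) (hα1 : α ≤ 1) (hαβ : α < β) (hC : 0 ≤ C)
    (hH : ∀ s τ t : ℝ, s ≤ τ → τ ≤ t → ∀ (x : X)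
      (hs : x ∈ (A s).domain) (hτ : x ∈ (A τ).domain) (ht : x ∈ (A t).domain),
      ‖A t ⟨x, ht⟩ - A s ⟨x, hs⟩‖ ≤ C * |t - s| ^ β * ‖A τ ⟨x, hτ⟩‖ ^ α * ‖x‖ ^ (1 - α))
    (hω : 0 ≤ ω) (hexp : ∀ t τ, 0 ≤ τ → ‖expSemigroup (A t) τ‖ ≤ Real.exp (ω * τ))
    (hGT : Real.exp (ω * T) ≤ G)
    (hG : ∀ t τ, 0 < τ → τ ≤ T → ∀ y : (A t).domain,
      ‖expSemigroup (A t) τ (A t y)‖ ≤ G / τ * ‖(y : X)‖)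
    (s : ℝ) {h : ℝ} (hh : 0 < h) (hhT : h ≤ T) :
    ‖U (s + h) s - expSemigroup (A s) h‖ ≤
      Real.exp (ω * T) * Real.exp (ω * T) * (C * G) * (h * h ^ (β - α)) := by
  have hG0 : 0 ≤ G := (Real.exp_pos _).le.trans hGT
  set E : ℝ := Real.exp (ω * T)
  have hE0 : 0 ≤ E := (Real.exp_pos _).le
  refine ContinuousLinearMap.opNorm_le_bound _ (by positivity) fun x => ?_
  -- Both sides are continuous in `x`, so the bound need only be checked for classical initial
  -- values.
  refine (hU.2 s).induction
    (P := fun x => ‖(U (s + h) s - expSemigroup (A s) h) x‖ ≤ E * E * (C * G) *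
      (h * h ^ (β - α)) * ‖x‖) ?_ (isClosed_le (by fun_prop) (by fun_prop)) x
  intro y (hy : IsClassicalSolution A s y fun t => U t s y)
  have hyD : y ∈ (A s).domain := by
    have := hy.mem_domain s le_rfl
    rwa [hy.init] at this
  obtain ⟨N, hNpos, hN⟩ := exists_norm_sub_timeOrderedProd_le (h := h) hA hα hα1 hαβ hC hH hω hexp hy
  have hN0 : ∀ n : ℕ, 1 ≤ n → ‖(U (s + h) s - expSemigroup (A s) h) y‖ ≤
      E * E * h * C * N * (h / n) ^ β + E * E * (C * G) * (h * h ^ (β - α)) * ‖y‖ := by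
    intro n hn
    have hn0 : (0 : ℝ) < n := by exact_mod_cast hn
    set d : ℝ := h / n
    have hd : 0 < d := by positivity
    have hnd : n * d = h := mul_div_cancel₀ h hn0.ne'
    have hdh : d ≤ h := div_le_self hh.le (by exact_mod_cast hn)
    have h1 := hN n d hd hnd
    have h2 := norm_expSemigroup_sub_timeOrderedProd_le hA hα hα1 hαβ hC hH hω hexp hGT hG s hd
      (n := n) (by rw [hnd]; exact hhT) ⟨y, hyD⟩
    rw [hnd] at h2
    have e1 : Real.exp (n * (ω * d)) ≤ E := by
      refine Real.exp_le_exp.2 ?_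
      rw [mul_left_comm, hnd]
      gcongr
    have e2 : Real.exp (ω * d) ≤ E := Real.exp_le_exp.2 (by gcongr; exact hdh.trans hhT)
    have h1' : ‖U (s + h) s y - timeOrderedProd (fun k => expSemigroup (A (s + k * d)) d) n y‖ ≤
        E * E * h * C * N * d ^ β := by
      refine h1.trans ?_
      calc Real.exp (n * (ω * d)) * (n * (Real.exp (ω * d) * (C * d ^ β * N) * d))
          ≤ E * (n * (E * (C * d ^ β * N) * d)) := by
            gcongr
        _ = E * E * (n * d) * C * N * d ^ β := by ring
        _ = _ := by rw [hnd]
    have h2' : ‖expSemigroup (A s) h y -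
        timeOrderedProd (fun k => expSemigroup (A (s + k * d)) d) n y‖ ≤
        E * E * (C * G) * (h * h ^ (β - α)) * ‖y‖ := by
      refine h2.trans ?_
      calc Real.exp (n * (ω * d)) *
            (n * (Real.exp (ω * d) * (C * G * h ^ (β - α) * ‖y‖) * d))
          ≤ E * (n * (E * (C * G * h ^ (β - α) * ‖y‖) * d)) := by gcongr
        _ = E * E * (C * G) * ((n * d) * h ^ (β - α)) * ‖y‖ := by ring
        _ = _ := by rw [hnd]
    rw [sub_apply]
    refine (norm_sub_le_norm_sub_add_norm_sub _
      (timeOrderedProd (fun k => expSemigroup (A (s + k * d)) d) n y) _).trans ?_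
    rw [norm_sub_rev _ (expSemigroup (A s) h y)]
    exact add_le_add h1' h2'
  have hβ : 0 < β := by linarith
  -- Refining the grid removes the term with the `y`-dependent `N`; the remaining one is uniform.
  have hlim : Tendsto (fun n : ℕ => E * E * h * C * N * (h / n) ^ β +
      E * E * (C * G) * (h * h ^ (β - α)) * ‖y‖) atTop
      (𝓝 (E * E * (C * G) * (h * h ^ (β - α)) * ‖y‖)) := by
    have h0 : Tendsto (fun n : ℕ => (h / n) ^ β) atTop (𝓝 0) := by
      have := (tendsto_const_div_atTop_nhds_zero_nat h).rpow_const (p := β) (Or.inr hβ.le)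
      rwa [Real.zero_rpow hβ.ne'] at this
    simpa using (h0.const_mul (E * E * h * C * N)).add_const
      (E * E * (C * G) * (h * h ^ (β - α)) * ‖y‖)
  exact ge_of_tendsto hlim (by filter_upwards [eventually_ge_atTop 1] with n hn using hN0 n hn)

/-- The constant depends only on `K`, `ω` and `T`, hence not on the freezing time. Since `ω ≥ 0`,
the half-plane `Re z > ω` lies where the uniform resolvent bound holds. -/
theorem Parabolic.exists_smoothing_bound [CompleteSpace X] {A : ℝ → X →ₗ.[ℂ] X}
    (hA : Parabolic A) {ω : ℝ} (hω : 0 ≤ ω)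
    (hexp : ∀ t τ, 0 ≤ τ → ‖expSemigroup (A t) τ‖ ≤ Real.exp (ω * τ)) (T : ℝ) :
    ∃ G : ℝ, ∀ t τ, 0 < τ → τ ≤ T → ∀ y : (A t).domain,
      ‖expSemigroup (A t) τ (A t y)‖ ≤ G / τ * ‖(y : X)‖ := by
  obtain ⟨K, hK1, hK⟩ := hA.resolvent_bound
  have hK0 : 0 ≤ K := zero_le_one.trans hK1
  refine ⟨Real.exp (1 + ω * T) * ((K + 1) * K ^ 2), fun t τ hτ hτT y => ?_⟩
  obtain ⟨hS, hgen⟩ := expSemigroup_spec (hA.analytic t).1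
  refine (norm_apply_generator_le hS hgen hω hK0 (hexp t) (fun z hz => ?_) hτ y).trans ?_
  · have hz0 : 0 < z.re := hω.trans_lt hz
    refine ⟨resolvent (A t) z, isResolventAt_resolvent (hA.resolvent_mem t z hz0.le),
      (hK t z hz0.le).trans ?_⟩
    have : 0 < ‖z‖ := hz0.trans_le (Complex.re_le_norm z)
    gcongr
    linarith
  · gcongr

end NCP

theorem mainTheorem5 {X : Type*} [NormedAddCommGroup X] [NormedSpace ℂ X] [CompleteSpace X]
    (A : ℝ → X →ₗ.[ℂ] X) (hA : NCP.Parabolic A)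
    (α β : ℝ) (hHolder : NCP.HolderCondition A α β)
    (U : ℝ → ℝ → X →L[ℂ] X) (hU : NCP.SolvesNCP A U) :
    ∃ C : ℝ → ℝ, ∀ T : ℝ, 0 < T → ∀ M : ℕ, 1 ≤ M →
      ‖U T 0 - NCP.freezingProd A (T / M) M‖ ≤ C T * (T / M) ^ (β - α) := by
  obtain ⟨α, β, hα1, hαβ', hα, hαβ, C, hH⟩ := hHolder.exists_le_one hA.domain_eq
  rw [← hαβ']
  have hH' : ∀ s τ t : ℝ, s ≤ τ → τ ≤ t → ∀ (x : X)
      (hs : x ∈ (A s).domain) (hτ : x ∈ (A τ).domain) (ht : x ∈ (A t).domain),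
      ‖A t ⟨x, ht⟩ - A s ⟨x, hs⟩‖ ≤
        |C| * |t - s| ^ β * ‖A τ ⟨x, hτ⟩‖ ^ α * ‖x‖ ^ (1 - α) := by
    intro s τ t hsτ hτt x hs hτ ht
    refine (hH s τ t hsτ hτt x hs hτ ht).trans ?_
    have := le_abs_self C
    gcongr
  obtain ⟨ω₀, hω₀⟩ := hA.exp_bound
  obtain ⟨ω₁, hω₁⟩ := hU.1.exp_bound
  -- One nonnegative exponent serves both families, making the exponential bounds monotone in time.
  set ω := max 0 (max ω₀ ω₁)
  have hω : 0 ≤ ω := le_max_left _ _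
  have hω₀' : ω₀ ≤ ω := (le_max_left _ _).trans (le_max_right _ _)
  have hω₁' : ω₁ ≤ ω := (le_max_right _ _).trans (le_max_right _ _)
  have hexp : ∀ t τ, 0 ≤ τ → ‖NCP.expSemigroup (A t) τ‖ ≤ Real.exp (ω * τ) := fun t τ hτ =>
    (hω₀ t τ hτ).trans (by gcongr)
  have hUexp : ∀ t s, s ≤ t → ‖U t s‖ ≤ Real.exp (ω * (t - s)) := fun t s hst =>
    (hω₁ t s hst).trans (by have := sub_nonneg.2 hst; gcongr)
  choose G₀ hG₀ using hA.exists_smoothing_bound hω hexp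
  -- The maximum makes one constant bound both the semigroup and its smoothing, so that the powers
  -- `α` and `1 - α` recombine to `G * ‖y‖`.
  let G : ℝ → ℝ := fun T => max (G₀ T) (Real.exp (ω * T))
  let E : ℝ → ℝ := fun T => Real.exp (ω * T)
  refine ⟨fun T => E T * T * (E T * E T * (|C| * G T)) * E T, fun T hT M hM => ?_⟩
  have hG : ∀ t τ, 0 < τ → τ ≤ T → ∀ y : (A t).domain,
      ‖NCP.expSemigroup (A t) τ (A t y)‖ ≤ G T / τ * ‖(y : X)‖ := by
    intro t τ hτ hτT y
    refine (hG₀ T t τ hτ hτT y).trans ?_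
    have : G₀ T ≤ G T := le_max_left _ _
    gcongr
  have hG0 : 0 ≤ G T := (Real.exp_pos _).le.trans (le_max_right _ _)
  have hE0 : 0 ≤ E T := (Real.exp_pos _).le
  have hM0 : (0 : ℝ) < M := by exact_mod_cast hM
  set d : ℝ := T / M
  have hd : 0 < d := by positivity
  have hMd : M * d = T := mul_div_cancel₀ T hM0.ne'
  have hdT : d ≤ T := div_le_self hT.le (by exact_mod_cast hM)
  refine ContinuousLinearMap.opNorm_le_bound _ (by positivity) fun x => ?_
  -- The exact trajectory plays the role of the sequence; the last factor `E T * ‖x‖` bounds it at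
  -- the grid points, where the local error operator is applied.
  have key := NCP.norm_sub_timeOrderedProd_le (X := X)
    (F := fun k => NCP.expSemigroup (A (k * d)) d) (v := fun k => U (k * d) 0 x) (a := ω * d)
    (ε := E T * E T * (|C| * G T) * (d * d ^ (β - α)) * (E T * ‖x‖)) (n := M)
    (by positivity) (by positivity) (fun k _ => hexp _ _ hd.le) ?_
  · rw [hMd, Nat.cast_zero, zero_mul, hU.1.refl, mul_left_comm (M : ℝ) ω d, hMd] at key
    refine key.trans_eq ?_
    calc E T * (M * (E T * E T * (|C| * G T) * (d * d ^ (β - α)) * (E T * ‖x‖)))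
        = E T * (M * d) * (E T * E T * (|C| * G T)) * E T * d ^ (β - α) * ‖x‖ := by ring
      _ = _ := by rw [hMd]
  intro k hk
  have hkd : 0 ≤ k * d := by positivity
  have hkT : k * d ≤ T := by
    rw [← hMd]
    gcongr
  have hloc := NCP.norm_sub_expSemigroup_le hA hU hα hα1 hαβ (abs_nonneg C) hH' hω hexp
    (le_max_right _ _) hG (k * d) hd hdT
  have hUx : ‖U (k * d) 0 x‖ ≤ E T * ‖x‖ := by
    refine (U (k * d) 0).le_of_opNorm_le ((hUexp _ _ hkd).trans ?_) x
    refine Real.exp_le_exp.2 ?_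
    rw [sub_zero]
    gcongr
  have e : U ((k + 1 : ℕ) * d) 0 x = U (k * d + d) (k * d) (U (k * d) 0 x) := by
    rw [← ContinuousLinearMap.comp_apply, hU.1.comp _ _ _ hkd (by linarith)]
    congr 2
    push_cast
    ring
  change ‖U ((k + 1 : ℕ) * d) 0 x - NCP.expSemigroup (A (k * d)) d (U (k * d) 0 x)‖ ≤ _
  rw [e, ← sub_apply]
  exact ContinuousLinearMap.le_of_opNorm_le_of_le _ hloc hUx
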